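/- All Banach spaces are complex; $X\widehat\otimes Y$ is the projective tensor product. A \emph{projective tensor quasinorm} is a function $\alpha$ with values in $[0,\infty]$, defined on all $X\widehat\otimes Y$ ($X,Y$ Banach spaces), such that $\alpha(u)=0$ implies $u=0$, $\alpha(cu)=|c|\,\alpha(u)$, $\alpha(x\otimes y)=\|x\|\,\|y\|$, $\alpha(u_1+u_2)\le C_\alpha[\alpha(u_1)+\alpha(u_2)]$ with one constant $C_\alpha>0$ for all $X,Y$, and $\alpha((A\otimes B)u)\le\|A\|\,\alpha(u)\,\|B\|$ for bounded operators $A,B$. Let $X\widehat\otimes_\alpha Y$ be the $\alpha$-closure of $X\otimes Y$ in $\{u\in X\widehat\otimes Y:\alpha(u)<\infty\}$; $\alpha$ is \emph{complete} if every $X\widehat\otimes_\alpha Y$ is complete. Let $N_\alpha(X)\subset L(X,X)$ be the set of operators $\widetilde u$ induced by the elements $u\in X^*\widehat\otimes_\alpha X$, with the quasinorm $\|T\|_{N_\alpha}=\inf\{\alpha(u): u\in X^*\widehat\otimes_\alpha X,\ \widetilde u=T\}$. For a Banach space $E$ with a normalized $1$-unconditional basis $(e_n)_{n\ge1}$, the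 direct sum $(\sum X_n)_E$ of Banach spaces $X_1,X_2,\dots$ is the space of sequences $(x_n)$, $x_n\in X_n$, for which $\sum_n\|x_n\|e_n$ converges in $E$, with the norm $\|(x_n)\|=\bigl\|\sum_n\|x_n\|e_n\bigr\|_E$. For $0<t<\infty$, $0<u\le\infty$, the Lorentz space $l_{t,u}$ consists of the null families $a$ of complex numbers with $\|a\|_{l_{t,u}}<\infty$, where $\|a\|_{l_{t,u}}=\bigl(\sum_{n\ge1}(a_n^*)^u n^{u/t-1}\bigr)^{1/u}$ for $u<\infty$, $\|a\|_{l_{t,\infty}}=\sup_{n\ge1}a_n^*n^{1/t}$, and $a_n^*=\inf_{|J|<n}\sup_{j\notin J}|a_j|$. A set of operators has \emph{spectral type} $l_{t,u}$ if, for each of its members $T$, the nonzero eigenvalues of $T$ have finite algebraic multiplicity and no accumulation point other than $0$, and the family $(\mu_k(T))$ of all nonzero eigenvalues, repeated according to algebraic multiplicity, lies in $l_{t,u}$. \textbf{Proposition (uniform boundedness principle).} Let $0<t<\infty$, $0<u\le\infty$, let $\alpha$ be a complete projective tensor quasinorm, let $E$ be a Banach space with a normalized $1$-unconditional basis, and let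 $\mathcal F$ be a family of Banach spaces closed under countable $E$-direct sums, i.e. for every sequence $X_1,X_2,\dots$ of members of $\mathcal F$ the space $(\sum X_n)_E$ is, up to isometric isomorphism, a member of $\mathcal F$. If $N_\alpha(X)$ has spectral type $l_{t,u}$ for every $X\in\mathcal F$, then there is a constant $C>0$ such that for every $X\in\mathcal F$ and every $T\in N_\alpha(X)$ $$\|(\mu_k(T))\|_{l_{t,u}}\le C\,\|T\|_{N_\alpha}.$$ -/

import Mathlib

open scoped ENNReal NNReal TensorProduct Topology
open Filter

universe v w

noncomputable section

namespace NuclearSpectral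

/-! ### Projective tensor products -/

section Projective

variable (X Y : Type*) [NormedAddCommGroup X] [NormedSpace ℂ X]
  [NormedAddCommGroup Y] [NormedSpace ℂ Y]

/-- The algebraic tensor product `X ⊗ Y`, to be equipped with the projective norm. -/
def AlgTensor : Type _ := X ⊗[ℂ] Y

instance : AddCommGroup (AlgTensor X Y) := inferInstanceAs (AddCommGroup (X ⊗[ℂ] Y))
instance : Module ℂ (AlgTensor X Y) := inferInstanceAs (Module ℂ (X ⊗[ℂ] Y))

variable {X Y}

/-- The elementary tensor `x ⊗ y`. -/
def AlgTensor.tmul (x : X) (y : Y) : AlgTensor X Y := x ⊗ₜ[ℂ] y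

/-- The values `∑ ‖x k‖ ‖y k‖` over all finite representations `∑ x k ⊗ y k` of a tensor. -/
def AlgTensor.reprValues (z : AlgTensor X Y) : Set ℝ :=
  {r | ∃ (n : ℕ) (x : Fin n → X) (y : Fin n → Y),
    z = ∑ k, AlgTensor.tmul (x k) (y k) ∧ r = ∑ k, ‖x k‖ * ‖y k‖}

/-- The projective norm: the infimum of `∑ ‖x k‖ ‖y k‖` over all finite representations. -/
instance : Norm (AlgTensor X Y) := ⟨fun z => sInf z.reprValues⟩

theorem AlgTensor.norm_def (z : AlgTensor X Y) : ‖z‖ = sInf z.reprValues := rfl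

theorem AlgTensor.reprValues_nonneg (z : AlgTensor X Y) : ∀ r ∈ z.reprValues, 0 ≤ r := by
  rintro r ⟨n, x, y, -, rfl⟩
  positivity

theorem AlgTensor.reprValues_bddBelow (z : AlgTensor X Y) : BddBelow z.reprValues :=
  ⟨0, fun r hr => z.reprValues_nonneg r hr⟩

theorem AlgTensor.reprValues_add {z z' : AlgTensor X Y} {r r' : ℝ} (h : r ∈ z.reprValues)
    (h' : r' ∈ z'.reprValues) : r + r' ∈ (z + z').reprValues := by
  obtain ⟨n, x, y, rfl, rfl⟩ := h
  obtain ⟨m, x', y', rfl, rfl⟩ := h'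
  exact ⟨n + m, Fin.append x x', Fin.append y y', by simp [Fin.sum_univ_add],
    by simp [Fin.sum_univ_add]⟩

theorem AlgTensor.reprValues_smul (c : ℂ) {z : AlgTensor X Y} {r : ℝ} (h : r ∈ z.reprValues) :
    ‖c‖ * r ∈ (c • z).reprValues := by
  obtain ⟨n, x, y, rfl, rfl⟩ := h
  refine ⟨n, fun k => c • x k, y, ?_, ?_⟩
  · rw [Finset.smul_sum]
    exact Finset.sum_congr rfl fun k _ => (TensorProduct.smul_tmul' c (x k) (y k))
  · rw [Finset.mul_sum]
    exact Finset.sum_congr rfl fun k _ => by rw [norm_smul, mul_assoc]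

theorem AlgTensor.reprValues_nonempty (z : AlgTensor X Y) : z.reprValues.Nonempty := by
  refine TensorProduct.induction_on (motive := fun z : X ⊗[ℂ] Y =>
    (AlgTensor.reprValues (X := X) (Y := Y) z).Nonempty) z ?_ ?_ ?_
  · exact ⟨0, 0, 0, 0, by simp; rfl, by simp⟩
  · intro x y
    exact ⟨‖x‖ * ‖y‖, 1, fun _ => x, fun _ => y, by simp; rfl, by simp⟩
  · rintro z z' ⟨r, hr⟩ ⟨r', hr'⟩
    exact ⟨r + r', AlgTensor.reprValues_add hr hr'⟩

theorem AlgTensor.core : SeminormedSpace.Core ℂ (AlgTensor X Y) where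
  norm_nonneg z := Real.sInf_nonneg z.reprValues_nonneg
  norm_smul := by
    have key : ∀ (c : ℂ) (z : AlgTensor X Y), ‖c • z‖ ≤ ‖c‖ * ‖z‖ := by
      intro c z
      rcases eq_or_ne c 0 with rfl | hc
      · obtain ⟨r, hr⟩ := z.reprValues_nonempty
        have := csInf_le (AlgTensor.reprValues_bddBelow _) (AlgTensor.reprValues_smul 0 hr)
        rw [norm_zero, zero_mul] at this ⊢
        exact this
      · have hc' : 0 < ‖c‖ := norm_pos_iff.2 hc
        rw [← div_le_iff₀' hc']
        refine le_csInf z.reprValues_nonempty fun r hr => ?_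
        rw [div_le_iff₀' hc']
        exact csInf_le (AlgTensor.reprValues_bddBelow _) (AlgTensor.reprValues_smul c hr)
    intro c z
    refine le_antisymm (key c z) ?_
    rcases eq_or_ne c 0 with rfl | hc
    · rw [norm_zero, zero_mul]
      exact Real.sInf_nonneg (AlgTensor.reprValues_nonneg _)
    · have h := key c⁻¹ (c • z)
      rw [smul_smul, inv_mul_cancel₀ hc, one_smul, norm_inv] at h
      rwa [← le_inv_mul_iff₀ (norm_pos_iff.2 hc)]
  norm_triangle z z' := by
    refine le_of_forall_pos_lt_add fun ε hε => ?_
    obtain ⟨r, hr, h⟩ := Real.lt_sInf_add_pos z.reprValues_nonempty (half_pos hε)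
    obtain ⟨r', hr', h'⟩ := Real.lt_sInf_add_pos z'.reprValues_nonempty (half_pos hε)
    have := csInf_le (AlgTensor.reprValues_bddBelow _) (AlgTensor.reprValues_add hr hr')
    simp only [AlgTensor.norm_def]
    linarith

instance : SeminormedAddCommGroup (AlgTensor X Y) := SeminormedAddCommGroup.ofCore AlgTensor.core
instance : NormedSpace ℂ (AlgTensor X Y) where
  norm_smul_le c z := (AlgTensor.core.norm_smul c z).le

theorem AlgTensor.norm_tmul_le (x : X) (y : Y) : ‖AlgTensor.tmul x y‖ ≤ ‖x‖ * ‖y‖ :=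
  csInf_le (AlgTensor.reprValues_bddBelow _) ⟨1, fun _ => x, fun _ => y, by simp, by simp⟩

theorem AlgTensor.bound_of_tmul {Z : Type*} [SeminormedAddCommGroup Z] [NormedSpace ℂ Z]
    (f : AlgTensor X Y →ₗ[ℂ] Z) (C : ℝ) (hC : 0 ≤ C)
    (h : ∀ x y, ‖f (AlgTensor.tmul x y)‖ ≤ C * (‖x‖ * ‖y‖)) (z : AlgTensor X Y) :
    ‖f z‖ ≤ C * ‖z‖ := by
  have key : ∀ r ∈ z.reprValues, ‖f z‖ ≤ C * r := by
    rintro r ⟨n, x, y, rfl, rfl⟩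
    rw [map_sum, Finset.mul_sum]
    exact (norm_sum_le _ _).trans (Finset.sum_le_sum fun k _ => h _ _)
  rcases hC.eq_or_lt with rfl | hC
  · obtain ⟨r, hr⟩ := z.reprValues_nonempty
    simpa using key r hr
  · rw [← div_le_iff₀' hC]
    exact le_csInf z.reprValues_nonempty fun r hr => (div_le_iff₀' hC).2 (key r hr)

variable (X Y) in
/-- The projective tensor product `X ⊗̂ Y`: the completion of `X ⊗ Y` in the projective norm. -/
abbrev ProjTensor : Type _ := UniformSpace.Completion (AlgTensor X Y)

/-- The elementary tensor `x ⊗ y` as an element of `X ⊗̂ Y`. -/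
def ProjTensor.tmul (x : X) (y : Y) : ProjTensor X Y :=
  ((AlgTensor.tmul x y : AlgTensor X Y) : ProjTensor X Y)

variable {X' Y' : Type*} [NormedAddCommGroup X'] [NormedSpace ℂ X']
  [NormedAddCommGroup Y'] [NormedSpace ℂ Y']

/-- `A ⊗ B` on algebraic tensor products, as a linear map. -/
def AlgTensor.mapₗ (A : X →L[ℂ] X') (B : Y →L[ℂ] Y') : AlgTensor X Y →ₗ[ℂ] AlgTensor X' Y' :=
  TensorProduct.map (A : X →ₗ[ℂ] X') (B : Y →ₗ[ℂ] Y')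

theorem AlgTensor.mapₗ_tmul (A : X →L[ℂ] X') (B : Y →L[ℂ] Y') (x : X) (y : Y) :
    AlgTensor.mapₗ A B (AlgTensor.tmul x y) = AlgTensor.tmul (A x) (B y) := rfl

/-- `A ⊗ B` on algebraic tensor products, as a bounded operator. -/
def AlgTensor.map (A : X →L[ℂ] X') (B : Y →L[ℂ] Y') : AlgTensor X Y →L[ℂ] AlgTensor X' Y' :=
  (AlgTensor.mapₗ A B).mkContinuous (‖A‖ * ‖B‖)
    (AlgTensor.bound_of_tmul _ _ (by positivity) fun x y => by
      rw [AlgTensor.mapₗ_tmul]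
      refine (AlgTensor.norm_tmul_le (A x) (B y)).trans ?_
      calc ‖A x‖ * ‖B y‖ ≤ (‖A‖ * ‖x‖) * (‖B‖ * ‖y‖) := by
            gcongr
            exacts [A.le_opNorm x, B.le_opNorm y]
        _ = _ := by ring)

/-- `A ⊗ B : X ⊗̂ Y → X' ⊗̂ Y'`, the continuous extension of `x ⊗ y ↦ A x ⊗ B y`. -/
def ProjTensor.map (A : X →L[ℂ] X') (B : Y →L[ℂ] Y') : ProjTensor X Y →L[ℂ] ProjTensor X' Y' :=
  (AlgTensor.map A B).completion

/-- The linear map sending `∑ x'ₖ ⊗ yₖ` to the finite rank operator `x ↦ ∑ x'ₖ(x) yₖ`. -/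
def AlgTensor.toOpₗ : AlgTensor (StrongDual ℂ X) Y →ₗ[ℂ] (X →L[ℂ] Y) :=
  TensorProduct.lift (LinearMap.mk₂ ℂ (fun (f : StrongDual ℂ X) (y : Y) => f.smulRight y)
    (fun f g y => by ext; simp [add_smul]) (fun c f y => by ext; simp [mul_smul])
    (fun f y y' => by ext; simp) (fun c f y => by ext; simp [smul_comm c]))

theorem AlgTensor.toOpₗ_tmul (f : StrongDual ℂ X) (y : Y) :
    AlgTensor.toOpₗ (AlgTensor.tmul f y) = f.smulRight y := rfl

/-- The map `AlgTensor.toOpₗ` as a bounded operator into `L(X, Y)`. -/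
def AlgTensor.toOp : AlgTensor (StrongDual ℂ X) Y →L[ℂ] (X →L[ℂ] Y) :=
  AlgTensor.toOpₗ.mkContinuous 1
    (AlgTensor.bound_of_tmul _ _ zero_le_one fun f y => by
      rw [AlgTensor.toOpₗ_tmul, one_mul]
      exact (ContinuousLinearMap.norm_smulRight_apply f y).le)

/-- The canonical map `X* ⊗̂ Y → L(X, Y)`, `u ↦ ũ`, sending `x' ⊗ y` to `x'(·) y`. -/
def ProjTensor.toOp [CompleteSpace Y] :
    ProjTensor (StrongDual ℂ X) Y →L[ℂ] (X →L[ℂ] Y) :=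
  AlgTensor.toOp.fromCompletion

theorem ProjTensor.map_tmul (A : X →L[ℂ] X') (B : Y →L[ℂ] Y') (x : X) (y : Y) :
    ProjTensor.map A B (ProjTensor.tmul x y) = ProjTensor.tmul (A x) (B y) := by
  simp only [ProjTensor.map, ProjTensor.tmul, ContinuousLinearMap.completion_apply_coe]
  rfl

theorem ProjTensor.toOp_tmul [CompleteSpace Y] (f : StrongDual ℂ X) (y : Y) (x : X) :
    ProjTensor.toOp (ProjTensor.tmul f y) x = f x • y := by
  simp only [ProjTensor.toOp, ProjTensor.tmul, ContinuousLinearMap.fromCompletion_apply_coe]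
  rfl

end Projective

/-! ### Projective tensor quasinorms and `α`-nuclear operators -/

/-- A projective tensor quasinorm: an extended-valued function `α` on all projective tensor
products of Banach spaces, a quasinorm on each of them with a common constant in the
quasi-triangle inequality, which is a cross-norm and has the metric mapping property. -/
structure ProjTensorQuasinorm where
  /-- The value `α(u)` for `u ∈ X ⊗̂ Y`. -/
  toFun : ∀ (X Y : Type v) [NormedAddCommGroup X] [NormedSpace ℂ X] [CompleteSpace X]
    [NormedAddCommGroup Y] [NormedSpace ℂ Y] [CompleteSpace Y], ProjTensor X Y → ℝ≥0∞
  eq_zero : ∀ (X Y : Type v) [NormedAddCommGroup X] [NormedSpace ℂ X] [CompleteSpace X]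
    [NormedAddCommGroup Y] [NormedSpace ℂ Y] [CompleteSpace Y] (u : ProjTensor X Y),
    toFun X Y u = 0 → u = 0
  smul : ∀ (X Y : Type v) [NormedAddCommGroup X] [NormedSpace ℂ X] [CompleteSpace X]
    [NormedAddCommGroup Y] [NormedSpace ℂ Y] [CompleteSpace Y] (c : ℂ) (u : ProjTensor X Y),
    toFun X Y (c • u) = ‖c‖ₑ * toFun X Y u
  tmul : ∀ (X Y : Type v) [NormedAddCommGroup X] [NormedSpace ℂ X] [CompleteSpace X]
    [NormedAddCommGroup Y] [NormedSpace ℂ Y] [CompleteSpace Y] (x : X) (y : Y),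
    toFun X Y (ProjTensor.tmul x y) = ‖x‖ₑ * ‖y‖ₑ
  add : ∃ C : ℝ≥0, 0 < C ∧
    ∀ (X Y : Type v) [NormedAddCommGroup X] [NormedSpace ℂ X] [CompleteSpace X]
      [NormedAddCommGroup Y] [NormedSpace ℂ Y] [CompleteSpace Y] (u₁ u₂ : ProjTensor X Y),
      toFun X Y (u₁ + u₂) ≤ C * (toFun X Y u₁ + toFun X Y u₂)
  map : ∀ (X Y X' Y' : Type v) [NormedAddCommGroup X] [NormedSpace ℂ X] [CompleteSpace X]
    [NormedAddCommGroup Y] [NormedSpace ℂ Y] [CompleteSpace Y]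
    [NormedAddCommGroup X'] [NormedSpace ℂ X'] [CompleteSpace X']
    [NormedAddCommGroup Y'] [NormedSpace ℂ Y'] [CompleteSpace Y']
    (A : X →L[ℂ] X') (B : Y →L[ℂ] Y') (u : ProjTensor X Y),
    toFun X' Y' (ProjTensor.map A B u) ≤ ‖A‖ₑ * toFun X Y u * ‖B‖ₑ

namespace ProjTensorQuasinorm

variable (α : ProjTensorQuasinorm.{v})

section

variable (X Y : Type v) [NormedAddCommGroup X] [NormedSpace ℂ X] [CompleteSpace X]
  [NormedAddCommGroup Y] [NormedSpace ℂ Y] [CompleteSpace Y]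

/-- The `α`-projective tensor product `X ⊗̂_α Y`: the `α`-closure of `X ⊗ Y` in
`{u ∈ X ⊗̂ Y : α u < ∞}`.  In particular `X ⊗ Y` is `α`-dense in it by definition. -/
def tensor : Set (ProjTensor X Y) :=
  {u | α.toFun X Y u < ∞ ∧ ∃ s : ℕ → AlgTensor X Y,
    Tendsto (fun n => α.toFun X Y (u - (s n : ProjTensor X Y))) atTop (𝓝 0)}

/-- The component `N_α(X, Y)`: the operators `ũ` with `u ∈ X* ⊗̂_α Y`. -/
def nuclear : Set (X →L[ℂ] Y) :=
  ProjTensor.toOp '' α.tensor (StrongDual ℂ X) Y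

variable {X Y}

/-- The `α`-nuclear quasinorm: the quotient quasinorm `inf {α u : u ∈ X* ⊗̂_α Y, ũ = T}`. -/
def nuclearNorm (T : X →L[ℂ] Y) : ℝ≥0∞ :=
  ⨅ u ∈ {u ∈ α.tensor (StrongDual ℂ X) Y | ProjTensor.toOp u = T},
    α.toFun (StrongDual ℂ X) Y u

end

/-- `α` is complete: in every `X ⊗̂_α Y`, every `α`-Cauchy sequence `α`-converges. -/
def IsComplete : Prop :=
  ∀ (X Y : Type v) [NormedAddCommGroup X] [NormedSpace ℂ X] [CompleteSpace X]
    [NormedAddCommGroup Y] [NormedSpace ℂ Y] [CompleteSpace Y] (s : ℕ → ProjTensor X Y),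
    (∀ n, s n ∈ α.tensor X Y) →
    (∀ ε : ℝ≥0∞, 0 < ε → ∃ N, ∀ m ≥ N, ∀ n ≥ N, α.toFun X Y (s m - s n) < ε) →
    ∃ u ∈ α.tensor X Y, Tendsto (fun n => α.toFun X Y (s n - u)) atTop (𝓝 0)

end ProjTensorQuasinorm

/-! ### Lorentz sequence spaces -/

section Lorentz

variable {ι : Type*}

/-- The `n`-th term (`n ≥ 1`) of the non-increasing rearrangement,
`inf_{|J| < n} sup_{j ∉ J} |a j|`. -/
def rearrangement (a : ι → ℂ) (n : ℕ) : ℝ≥0∞ :=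
  ⨅ J : {J : Finset ι // J.card < n}, ⨆ j : {j : ι // j ∉ J.1}, ‖a j‖ₑ

/-- The Lorentz quasinorm `‖a‖_{p,q}` of a family of complex numbers (`0 < p < ∞`, `0 < q ≤ ∞`). -/
def lorentzNorm (p : ℝ) (q : ℝ≥0∞) (a : ι → ℂ) : ℝ≥0∞ :=
  if q = ∞ then ⨆ n : ℕ, rearrangement a (n + 1) * ((n : ℝ≥0∞) + 1) ^ (1 / p)
  else (∑' n : ℕ, rearrangement a (n + 1) ^ q.toReal *
    ((n : ℝ≥0∞) + 1) ^ (q.toReal / p - 1)) ^ (1 / q.toReal)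

/-- Membership in `l_{p,q}`: a null family with finite Lorentz quasinorm. -/
def MemLorentz (p : ℝ) (q : ℝ≥0∞) (a : ι → ℂ) : Prop :=
  Tendsto a cofinite (𝓝 0) ∧ lorentzNorm p q a < ∞

end Lorentz

/-! ### Eigenvalues and spectral type -/

section Spectral

variable {X : Type*} [NormedAddCommGroup X] [NormedSpace ℂ X]

/-- The root subspace `⋃ₖ ker (T - μ)ᵏ`. -/
def rootSpace (T : X →L[ℂ] X) (μ : ℂ) : Submodule ℂ X :=
  Module.End.maxGenEigenspace (T : X →ₗ[ℂ] X) μ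

/-- The set of nonzero eigenvalues of `T`. -/
def nonzeroEigenvalues (T : X →L[ℂ] X) : Set ℂ :=
  {μ | μ ≠ 0 ∧ Module.End.HasEigenvalue (T : X →ₗ[ℂ] X) μ}

/-- The full family of nonzero eigenvalues of `T`, each repeated according to its algebraic
multiplicity. -/
def eigenvalueFamily (T : X →L[ℂ] X) :
    (Σ μ : nonzeroEigenvalues T, Fin (Module.finrank ℂ (rootSpace T μ))) → ℂ :=
  fun i => i.1

/-- `T` has spectral type `l_{p,q}`: its nonzero eigenvalues have finite algebraic multiplicity
and no accumulation point other than `0`, and, counted with multiplicity, belong to `l_{p,q}`. -/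
structure HasSpectralType (T : X →L[ℂ] X) (p : ℝ) (q : ℝ≥0∞) : Prop where
  finite_mult : ∀ μ ∈ nonzeroEigenvalues T, FiniteDimensional ℂ (rootSpace T μ)
  not_accPt : ∀ z : ℂ, z ≠ 0 → ¬ AccPt z (𝓟 (nonzeroEigenvalues T))
  memLorentz : MemLorentz p q (eigenvalueFamily T)

/-- A set of operators has spectral type `l_{p,q}` if each of its members does. -/
def OfSpectralType (A : Set (X →L[ℂ] X)) (p : ℝ) (q : ℝ≥0∞) : Prop :=
  ∀ T ∈ A, HasSpectralType T p q

end Spectral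

/-! ### Direct sums with respect to a 1-unconditional basis -/

/-- A normalized 1-unconditional basis `(eₖ)` of `E`. -/
structure OneUnconditionalBasis (E : Type*) [NormedAddCommGroup E] [NormedSpace ℂ E] where
  /-- The underlying unconditional basis, with its coordinate functionals. -/
  basis : UnconditionalSchauderBasis ℕ ℂ E
  norm_eq_one : ∀ k, ‖basis k‖ = 1
  norm_signs : ∀ t : ℕ → ℂ, (∀ k, t k = 1 ∨ t k = -1) → ∀ x y : E,
    HasSum (fun k => t k • basis.coord k x • basis k) y → ‖y‖ = ‖x‖

section BanachDirectSum

variable {E : Type*} [NormedAddCommGroup E] [NormedSpace ℂ E] (e : OneUnconditionalBasis E)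

namespace OneUnconditionalBasis

theorem coord_basis (i j : ℕ) : e.basis.coord i (e.basis j) = if i = j then 1 else 0 := by
  simp [e.basis.ortho, Pi.single_apply]

theorem norm_shrink_one (x : E) (k : ℕ) (s : ℝ) (h0 : 0 ≤ s) (h1 : s ≤ 1) :
    ‖x - (s : ℂ) • e.basis.coord k x • e.basis k‖ ≤ ‖x‖ := by
  set v : E := e.basis.coord k x • e.basis k with hv
  have hsum : HasSum (fun i => (if i = k then (-1 : ℂ) else 1) • e.basis.coord i x • e.basis i)
      (x - (2 : ℂ) • v) := by
    have h2 := (e.basis.expansion x).sub (hasSum_ite_eq k ((2 : ℂ) • v))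
    convert h2 using 2 with i
    split_ifs with h
    · subst h
      rw [← hv, two_smul, neg_one_smul]
      abel
    · simp
  have hy : ‖x - (2 : ℂ) • v‖ = ‖x‖ :=
    e.norm_signs _ (fun i => by split_ifs <;> simp) x _ hsum
  have hdec : x - (s : ℂ) • v = ((1 - s / 2 : ℝ) : ℂ) • x + ((s / 2 : ℝ) : ℂ) • (x - (2 : ℂ) • v) := by
    push_cast
    module
  rw [hdec]
  refine (norm_add_le _ _).trans ?_
  rw [norm_smul, norm_smul, hy, Complex.norm_real, Complex.norm_real, Real.norm_eq_abs,
    Real.norm_eq_abs, abs_of_nonneg (by linarith), abs_of_nonneg (by linarith)]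
  linarith

theorem norm_shrink (x : E) (s : ℕ → ℝ) (h0 : ∀ k, 0 ≤ s k) (h1 : ∀ k, s k ≤ 1) (F : Finset ℕ) :
    ‖x - ∑ k ∈ F, (s k : ℂ) • e.basis.coord k x • e.basis k‖ ≤ ‖x‖ := by
  induction F using Finset.induction_on with
  | empty => simp
  | insert k F hk ih =>
    refine le_trans ?_ ih
    have hc : e.basis.coord k (x - ∑ i ∈ F, (s i : ℂ) • e.basis.coord i x • e.basis i) =
        e.basis.coord k x := by
      rw [map_sub, map_sum, Finset.sum_eq_zero, sub_zero]
      intro i hi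
      have : k ≠ i := fun h => hk (h ▸ hi)
      simp [e.coord_basis, this]
    have := e.norm_shrink_one (x - ∑ i ∈ F, (s i : ℂ) • e.basis.coord i x • e.basis i) k (s k)
      (h0 k) (h1 k)
    rw [hc] at this
    rw [Finset.sum_insert hk, add_comm, ← sub_sub]
    exact this

theorem norm_finset_mono {a b : ℕ → ℝ} (h0 : ∀ k, 0 ≤ a k) (hab : ∀ k, a k ≤ b k)
    {F G : Finset ℕ} (hFG : F ⊆ G) :
    ‖∑ k ∈ F, (a k : ℂ) • e.basis k‖ ≤ ‖∑ k ∈ G, (b k : ℂ) • e.basis k‖ := by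
  set x : E := ∑ k ∈ G, (b k : ℂ) • e.basis k with hx
  have hc : ∀ k ∈ G, e.basis.coord k x = b k := by
    intro k hk
    simp [hx, e.coord_basis, hk]
  set s : ℕ → ℝ := fun k => if k ∈ F then 1 - a k / b k else 1 with hs
  have hb : ∀ k, 0 ≤ b k := fun k => (h0 k).trans (hab k)
  have h := e.norm_shrink x s
    (fun k => by
      simp only [hs]; split_ifs
      · have := div_le_one_of_le₀ (hab k) (hb k); linarith
      · exact zero_le_one)
    (fun k => by
      simp only [hs]; split_ifs
      · have := div_nonneg (h0 k) (hb k); linarith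
      · exact le_rfl) G
  have heq : x - ∑ k ∈ G, (s k : ℂ) • e.basis.coord k x • e.basis k =
      ∑ k ∈ F, (a k : ℂ) • e.basis k := by
    rw [hx, ← Finset.sum_sub_distrib, ← Finset.sum_subset hFG]
    · refine Finset.sum_congr rfl fun k hk => ?_
      rw [← hx, hc k (hFG hk), smul_smul, ← sub_smul]
      congr 1
      rcases (hb k).eq_or_lt with h | h
      · have : a k = 0 := le_antisymm (by rw [h]; exact hab k) (h0 k)
        simp [this, ← h]
      · have hne : b k ≠ 0 := h.ne'
        simp only [hs, if_pos hk]
        rw [← Complex.ofReal_mul, ← Complex.ofReal_sub]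
        congr 1
        field_simp
        ring
    · intro k hk hkF
      rw [← hx, hc k hk]
      simp [hs, hkF]
  rwa [heq] at h

theorem summable_mono [CompleteSpace E] {a b : ℕ → ℝ} (h0 : ∀ k, 0 ≤ a k) (hab : ∀ k, a k ≤ b k)
    (hb : Summable fun k => (b k : ℂ) • e.basis k) : Summable fun k => (a k : ℂ) • e.basis k := by
  rw [summable_iff_vanishing_norm] at hb ⊢
  intro ε hε
  obtain ⟨S, hS⟩ := hb ε hε
  exact ⟨S, fun F hF => (e.norm_finset_mono h0 hab subset_rfl).trans_lt (hS F hF)⟩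

theorem norm_tsum_mono {a b : ℕ → ℝ} (h0 : ∀ k, 0 ≤ a k) (hab : ∀ k, a k ≤ b k)
    (ha : Summable fun k => (a k : ℂ) • e.basis k)
    (hb : Summable fun k => (b k : ℂ) • e.basis k) :
    ‖∑' k, (a k : ℂ) • e.basis k‖ ≤ ‖∑' k, (b k : ℂ) • e.basis k‖ :=
  le_of_tendsto_of_tendsto' ha.hasSum.norm hb.hasSum.norm
    fun _ => e.norm_finset_mono h0 hab subset_rfl

end OneUnconditionalBasis

variable [CompleteSpace E] (X : ℕ → Type v) [∀ n, NormedAddCommGroup (X n)]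
  [∀ n, NormedSpace ℂ (X n)]

/-- The sequences `(xₙ)`, `xₙ ∈ Xₙ`, for which `∑ ‖xₙ‖ eₙ` converges in `E`. -/
def directSumSubmodule : Submodule ℂ (∀ n, X n) where
  carrier := {x | Summable fun n => ((‖x n‖ : ℝ) : ℂ) • e.basis n}
  zero_mem' := by simp
  add_mem' {x y} hx hy := by
    refine e.summable_mono (fun n => norm_nonneg _) (fun n => norm_add_le (x n) (y n)) ?_
    simpa [add_smul] using Summable.add hx hy
  smul_mem' c x hx := by
    simpa [norm_smul, mul_smul] using Summable.const_smul ((‖c‖ : ℝ) : ℂ) hx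

/-- The direct sum `(∑ Xₙ)_E`: the sequences `(xₙ)`, `xₙ ∈ Xₙ`, for which `∑ ‖xₙ‖ eₙ` converges
in `E`, with the norm `‖(xₙ)‖ = ‖∑ ‖xₙ‖ eₙ‖`. -/
def BanachDirectSum : Type v := directSumSubmodule e X

namespace BanachDirectSum

instance : AddCommGroup (BanachDirectSum e X) := inferInstanceAs (AddCommGroup (directSumSubmodule e X))
instance : Module ℂ (BanachDirectSum e X) := inferInstanceAs (Module ℂ (directSumSubmodule e X))

variable {e X}

/-- The `n`-th coordinate of an element of the direct sum. -/
def coord (x : BanachDirectSum e X) (n : ℕ) : X n := x.1 n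

theorem ext {x y : BanachDirectSum e X} (h : ∀ n, x.coord n = y.coord n) : x = y :=
  Subtype.ext (funext h)

theorem coord_add (x y : BanachDirectSum e X) (n : ℕ) : (x + y).coord n = x.coord n + y.coord n := rfl

theorem coord_smul (c : ℂ) (x : BanachDirectSum e X) (n : ℕ) : (c • x).coord n = c • x.coord n := rfl

theorem coord_zero (n : ℕ) : (0 : BanachDirectSum e X).coord n = 0 := rfl

theorem summable (x : BanachDirectSum e X) :
    Summable fun n => ((‖x.coord n‖ : ℝ) : ℂ) • e.basis n := x.2

instance : Norm (BanachDirectSum e X) := ⟨fun x => ‖∑' n, ((‖x.coord n‖ : ℝ) : ℂ) • e.basis n‖⟩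

theorem norm_def (x : BanachDirectSum e X) :
    ‖x‖ = ‖∑' n, ((‖x.coord n‖ : ℝ) : ℂ) • e.basis n‖ := rfl

theorem norm_coord_le (x : BanachDirectSum e X) (n : ℕ) : ‖x.coord n‖ ≤ ‖x‖ := by
  have h := e.norm_tsum_mono (a := fun k => if k = n then ‖x.coord n‖ else 0)
    (b := fun k => ‖x.coord k‖) (fun k => by split_ifs <;> positivity)
    (fun k => by
      split_ifs with h
      · rw [h]
      · exact norm_nonneg _)
    (summable_of_ne_finset_zero (s := {n}) fun k hk => by simp_all) x.summable
  rw [tsum_eq_single n fun k hk => by simp [hk]] at h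
  rw [if_pos rfl, norm_smul, e.norm_eq_one, mul_one, Complex.norm_real, norm_norm] at h
  exact h

theorem core : NormedSpace.Core ℂ (BanachDirectSum e X) where
  norm_nonneg x := norm_nonneg (∑' n, ((‖x.coord n‖ : ℝ) : ℂ) • e.basis n)
  norm_smul c x := by
    have : (fun n => ((‖(c • x).coord n‖ : ℝ) : ℂ) • e.basis n) =
        fun n => ((‖c‖ : ℝ) : ℂ) • ((‖x.coord n‖ : ℝ) : ℂ) • e.basis n := by
      ext n
      rw [coord_smul, norm_smul, Complex.ofReal_mul, mul_smul]
    rw [norm_def, norm_def, this, x.summable.tsum_const_smul, norm_smul]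
    simp
  norm_triangle x y := by
    have hs : Summable fun n => ((‖x.coord n‖ + ‖y.coord n‖ : ℝ) : ℂ) • e.basis n := by
      simpa [add_smul] using x.summable.add y.summable
    refine (e.norm_tsum_mono (fun n => norm_nonneg _)
      (fun n => norm_add_le (x.coord n) (y.coord n)) (x + y).summable hs).trans ?_
    rw [norm_def, norm_def]
    refine le_trans (le_of_eq ?_) (norm_add_le _ _)
    rw [← x.summable.tsum_add y.summable]
    simp [add_smul]
  norm_eq_zero_iff x := by
    constructor
    · intro h
      refine ext fun n => ?_
      have := norm_coord_le x n
      rw [h] at this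
      exact norm_le_zero_iff.1 this
    · rintro rfl
      simp [norm_def, coord_zero]

instance : NormedAddCommGroup (BanachDirectSum e X) := NormedAddCommGroup.ofCore core

instance : NormedSpace ℂ (BanachDirectSum e X) where
  norm_smul_le c x := (core.norm_smul c x).le

theorem norm_finset_le (x : BanachDirectSum e X) (F : Finset ℕ) :
    ‖∑ n ∈ F, ((‖x.coord n‖ : ℝ) : ℂ) • e.basis n‖ ≤ ‖x‖ :=
  ge_of_tendsto x.summable.hasSum.norm <| (eventually_ge_atTop F).mono fun _ hG =>
    e.norm_finset_mono (fun _ => norm_nonneg _) (fun _ => le_rfl) hG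

theorem norm_le_of_finset (x : BanachDirectSum e X) (C : ℝ)
    (h : ∀ F : Finset ℕ, ‖∑ n ∈ F, ((‖x.coord n‖ : ℝ) : ℂ) • e.basis n‖ ≤ C) : ‖x‖ ≤ C :=
  le_of_tendsto' x.summable.hasSum.norm h

instance [∀ n, CompleteSpace (X n)] : CompleteSpace (BanachDirectSum e X) := by
  refine Metric.complete_of_cauchySeq_tendsto fun s hs => ?_
  have hsub : ∀ x y : BanachDirectSum e X, ∀ n, (x - y).coord n = x.coord n - y.coord n :=
    fun _ _ _ => rfl
  have hlim : ∀ n, ∃ z : X n, Tendsto (fun m => (s m).coord n) atTop (𝓝 z) := by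
    intro n
    refine cauchySeq_tendsto_of_complete (Metric.cauchySeq_iff.2 fun ε hε => ?_)
    obtain ⟨N, hN⟩ := Metric.cauchySeq_iff.1 hs ε hε
    refine ⟨N, fun i hi j hj => ?_⟩
    rw [dist_eq_norm, ← hsub]
    refine (norm_coord_le _ n).trans_lt ?_
    rw [← dist_eq_norm]
    exact hN i hi j hj
  choose z hz using hlim
  have hest : ∀ ε > 0, ∃ N, ∀ m ≥ N, ∀ F : Finset ℕ,
      ‖∑ n ∈ F, ((‖(s m).coord n - z n‖ : ℝ) : ℂ) • e.basis n‖ ≤ ε := by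
    intro ε hε
    obtain ⟨N, hN⟩ := Metric.cauchySeq_iff.1 hs ε hε
    refine ⟨N, fun m hm F => ?_⟩
    have ht : Tendsto (fun l => ‖∑ n ∈ F, ((‖(s m).coord n - (s l).coord n‖ : ℝ) : ℂ) • e.basis n‖)
        atTop (𝓝 ‖∑ n ∈ F, ((‖(s m).coord n - z n‖ : ℝ) : ℂ) • e.basis n‖) := by
      refine (tendsto_finsetSum F fun n _ => ?_).norm
      refine Tendsto.smul_const ?_ _
      exact (Complex.continuous_ofReal.tendsto _).comp (tendsto_const_nhds.sub (hz n)).norm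
    refine le_of_tendsto ht ((eventually_ge_atTop N).mono fun l hl => ?_)
    refine (norm_finset_le (s m - s l) F).trans ?_
    rw [← dist_eq_norm]
    exact (hN m hm l hl).le
  have hmem : Summable fun n => ((‖z n‖ : ℝ) : ℂ) • e.basis n := by
    obtain ⟨N, hN⟩ := hest 1 one_pos
    rw [summable_iff_vanishing_norm]
    intro ε hε
    obtain ⟨N, hN⟩ := hest (ε / 2) (half_pos hε)
    obtain ⟨S, hS⟩ := summable_iff_vanishing_norm.1 (s N).summable (ε / 2) (half_pos hε)
    refine ⟨S, fun F hF => ?_⟩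
    have h1 := e.norm_finset_mono (F := F) (G := F) (a := fun n => ‖z n‖)
      (b := fun n => ‖(s N).coord n - z n‖ + ‖(s N).coord n‖) (fun n => norm_nonneg _)
      (fun n => by
        have := norm_sub_le ((s N).coord n) ((s N).coord n - z n)
        rw [sub_sub_cancel] at this
        linarith) subset_rfl
    simp only [Complex.ofReal_add, add_smul, Finset.sum_add_distrib] at h1
    have h2 := norm_add_le (∑ n ∈ F, ((‖(s N).coord n - z n‖ : ℝ) : ℂ) • e.basis n)
      (∑ n ∈ F, ((‖(s N).coord n‖ : ℝ) : ℂ) • e.basis n)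
    have h3 := hN N le_rfl F
    have h4 := hS F hF
    linarith
  let x : BanachDirectSum e X := ⟨z, hmem⟩
  refine ⟨x, Metric.tendsto_atTop.2 fun ε hε => ?_⟩
  obtain ⟨N, hN⟩ := hest (ε / 2) (half_pos hε)
  refine ⟨N, fun m hm => ?_⟩
  rw [dist_eq_norm]
  exact (norm_le_of_finset (s m - x) (ε / 2) (hN m hm)).trans_lt (half_lt_self hε)

end BanachDirectSum

end BanachDirectSum

/-! ### Families of Banach spaces -/

/-- A (complex) Banach space. -/
structure BanachSp where
  /-- The underlying type. -/
  carrier : Type v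
  [normedAddCommGroup : NormedAddCommGroup carrier]
  [normedSpace : NormedSpace ℂ carrier]
  [completeSpace : CompleteSpace carrier]

instance : CoeSort BanachSp.{v} (Type v) := ⟨BanachSp.carrier⟩

attribute [instance] BanachSp.normedAddCommGroup BanachSp.normedSpace BanachSp.completeSpace

/-- A family of Banach spaces is closed under countable `E`-direct sums if for every sequence
`X₀, X₁, …` of its members it contains a copy (up to isometric isomorphism) of `(∑ Xₙ)_E`. -/
def ClosedUnderDirectSums {E : Type w} [NormedAddCommGroup E] [NormedSpace ℂ E] [CompleteSpace E]
    (e : OneUnconditionalBasis E) (𝓕 : Set BanachSp.{v}) : Prop :=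
  ∀ X : ℕ → BanachSp.{v}, (∀ n, X n ∈ 𝓕) →
    ∃ Z ∈ 𝓕, Nonempty (Z ≃ₗᵢ[ℂ] BanachDirectSum e fun n => X n)

end NuclearSpectral

end

open NuclearSpectral

/-! The argument is a gliding hump. If no constant works, there are `X n` in the family and nuclear
`T n` on them whose eigenvalue quasinorm exceeds `(n + 1) * (2C)^n` times their nuclear quasinorm,
where `C ≥ 1` is a quasi-triangle constant of `α`. Spectral type makes each eigenvalue quasinorm
finite, so `T n` can be rescaled: `c n • T n` has eigenvalue quasinorm exactly `n + 1`, yet is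
induced by a tensor `w n` with `α (w n) ≤ (2C)^(-n)` (`exists_scaled_tensor`).

Let `Z` be the copy of the `E`-direct sum in the family, with coordinate projections `P n` and
embeddings `J n`. The tensors `(P n)* ⊗ J n` applied to `w n` keep the geometric bound, so by
completeness their sum `α`-converges, and the limit induces a nuclear operator `S` on `Z` with `S J
n = c n • J n T n` (`exists_nuclear_directSum`). To identify `S`, `α`-convergence must imply strong
convergence of the induced operators; this follows from the mapping property and the cross-norm
property (`enorm_toOp_apply_le`).

Since `J n` is injective and intertwines `c n • T n` with `S`, the eigenvalues of `c n • T n`, with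
multiplicity, form a subfamily of those of `S` (`enorm_mul_lorentzNorm_eigenvalueFamily_le`). The
eigenvalue quasinorm of `S` is therefore at least `n + 1` for every `n`, so it is infinite,
contradicting the spectral type on `Z`. -/

noncomputable section

namespace NuclearSpectral

/-! ### Operators induced by tensors. -/

section Projective

variable {X Y Z X' Y' : Type*} [NormedAddCommGroup X] [NormedSpace ℂ X]
  [NormedAddCommGroup Y] [NormedSpace ℂ Y] [NormedAddCommGroup Z] [NormedSpace ℂ Z]
  [NormedAddCommGroup X'] [NormedSpace ℂ X'] [NormedAddCommGroup Y'] [NormedSpace ℂ Y']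

/-- Bounded operators on `X ⊗̂ Y` are determined by their values on elementary tensors. -/
theorem ProjTensor.clm_ext {f g : ProjTensor X Y →L[ℂ] Z}
    (h : ∀ x y, f (ProjTensor.tmul x y) = g (ProjTensor.tmul x y)) : f = g := by
  ext w
  induction w using UniformSpace.Completion.induction_on with
  | hp => exact isClosed_eq f.continuous g.continuous
  | ih z =>
    refine TensorProduct.induction_on (motive := fun z : X ⊗[ℂ] Y =>
      f ((show AlgTensor X Y from z : AlgTensor X Y) : ProjTensor X Y) =
        g ((show AlgTensor X Y from z : AlgTensor X Y) : ProjTensor X Y)) z ?_ h ?_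
    · exact (map_zero f).trans (map_zero g).symm
    · intro z z' hz hz'
      have hadd := UniformSpace.Completion.coe_add (α := AlgTensor X Y) z z'
      exact (congrArg f hadd).trans ((map_add f _ _).trans ((congrArg₂ (· + ·) hz hz').trans
        ((map_add g _ _).symm.trans (congrArg g hadd.symm))))

/-- The operator `y ↦ x ⊗ y`. -/
def ProjTensor.tmulLeft (x : X) : Y →L[ℂ] ProjTensor X Y :=
  LinearMap.mkContinuous
    { toFun := fun y => ProjTensor.tmul x y
      map_add' := fun y y' => by
        rw [ProjTensor.tmul, ProjTensor.tmul, ProjTensor.tmul, ← UniformSpace.Completion.coe_add]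
        exact congrArg _ (TensorProduct.tmul_add x y y')
      map_smul' := fun c y => by
        rw [ProjTensor.tmul, ProjTensor.tmul, RingHom.id_apply, ← UniformSpace.Completion.coe_smul]
        exact congrArg _ (TensorProduct.tmul_smul c x y) } ‖x‖
    (fun y => (UniformSpace.Completion.norm_coe _).le.trans (AlgTensor.norm_tmul_le x y))

theorem ProjTensor.tmulLeft_apply (x : X) (y : Y) :
    ProjTensor.tmulLeft x y = ProjTensor.tmul x y := rfl

/-- Both sides are bounded and linear in `w`, so elementary tensors suffice. This moves a tensor
from a summand to the direct sum, with `P` a projection and `J` an embedding. -/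
theorem ProjTensor.toOp_map [CompleteSpace Y] [CompleteSpace Y'] (P : X' →L[ℂ] X)
    (J : Y →L[ℂ] Y') (w : ProjTensor (StrongDual ℂ X) Y) :
    ProjTensor.toOp (ProjTensor.map (ContinuousLinearMap.precomp ℂ P) J w) =
      J ∘L ProjTensor.toOp w ∘L P := by
  have h : ProjTensor.toOp ∘L ProjTensor.map (ContinuousLinearMap.precomp ℂ P) J =
      (ContinuousLinearMap.precomp Y' P) ∘L (ContinuousLinearMap.postcomp X J) ∘L
        ProjTensor.toOp := by
    refine ProjTensor.clm_ext fun f y => ?_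
    ext x
    simp [ProjTensor.map_tmul, ProjTensor.toOp_tmul]
  exact congrArg (fun F => F w) h

/-- Evaluation at `x` is written as a tensor map with rank-one first factor `f ↦ f x • f₀`, which
brings it within reach of the mapping property of `α`. -/
theorem ProjTensor.map_eval_smulRight [CompleteSpace Y] (x : X) (f₀ : StrongDual ℂ X)
    (w : ProjTensor (StrongDual ℂ X) Y) :
    ProjTensor.map ((ContinuousLinearMap.apply ℂ ℂ x).smulRight f₀) (ContinuousLinearMap.id ℂ Y) w =
      ProjTensor.tmul f₀ (ProjTensor.toOp w x) := by
  have h : ProjTensor.map ((ContinuousLinearMap.apply ℂ ℂ x).smulRight f₀)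
        (ContinuousLinearMap.id ℂ Y) =
      ProjTensor.tmulLeft f₀ ∘L (ContinuousLinearMap.apply ℂ Y x) ∘L ProjTensor.toOp := by
    refine ProjTensor.clm_ext fun f y => ?_
    rw [ProjTensor.map_tmul]
    simp only [ContinuousLinearMap.comp_apply, ContinuousLinearMap.apply_apply,
      ProjTensor.toOp_tmul, map_smul, ProjTensor.tmulLeft_apply, ContinuousLinearMap.id_apply,
      ContinuousLinearMap.smulRight_apply]
    rw [ProjTensor.tmul, ProjTensor.tmul, ← UniformSpace.Completion.coe_smul]
    rfl
  exact congrArg (fun F => F w) h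

end Projective

/-! ### Calculus of projective tensor quasinorms: linear structure, series, strong convergence. -/

namespace ProjTensorQuasinorm

variable (α : ProjTensorQuasinorm.{v})

section

variable {X Y X' Y' : Type v} [NormedAddCommGroup X] [NormedSpace ℂ X] [CompleteSpace X]
  [NormedAddCommGroup Y] [NormedSpace ℂ Y] [CompleteSpace Y]
  [NormedAddCommGroup X'] [NormedSpace ℂ X'] [CompleteSpace X']
  [NormedAddCommGroup Y'] [NormedSpace ℂ Y'] [CompleteSpace Y']

theorem toFun_zero : α.toFun X Y 0 = 0 := by
  simpa using α.smul X Y 0 0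

theorem toFun_neg (w : ProjTensor X Y) : α.toFun X Y (-w) = α.toFun X Y w := by
  simpa using α.smul X Y (-1) w

theorem toFun_map_le {A : X →L[ℂ] X'} {B : Y →L[ℂ] Y'} (hA : ‖A‖ ≤ 1) (hB : ‖B‖ ≤ 1)
    (w : ProjTensor X Y) : α.toFun X' Y' (ProjTensor.map A B w) ≤ α.toFun X Y w := by
  have hA' : ‖A‖ₑ ≤ 1 := by simpa [← ofReal_norm] using hA
  have hB' : ‖B‖ₑ ≤ 1 := by simpa [← ofReal_norm] using hB
  calc _ ≤ ‖A‖ₑ * α.toFun X Y w * ‖B‖ₑ := α.map X Y X' Y' A B w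
    _ ≤ 1 * α.toFun X Y w * 1 := by gcongr
    _ = _ := by simp

/-- The constant in the quasi-triangle inequality may be taken at least `1`. -/
theorem exists_one_le_add : ∃ C : ℝ≥0, 1 ≤ C ∧
    ∀ (X Y : Type v) [NormedAddCommGroup X] [NormedSpace ℂ X] [CompleteSpace X]
      [NormedAddCommGroup Y] [NormedSpace ℂ Y] [CompleteSpace Y] (u₁ u₂ : ProjTensor X Y),
      α.toFun X Y (u₁ + u₂) ≤ C * (α.toFun X Y u₁ + α.toFun X Y u₂) := by
  obtain ⟨C, -, hC⟩ := α.add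
  refine ⟨max 1 C, le_max_left _ _, fun X Y _ _ _ _ _ _ u₁ u₂ => (hC X Y u₁ u₂).trans ?_⟩
  gcongr
  exact le_max_right _ _

theorem smul_mem_tensor (c : ℂ) {w : ProjTensor X Y} (hw : w ∈ α.tensor X Y) :
    c • w ∈ α.tensor X Y := by
  obtain ⟨hfin, s, hs⟩ := hw
  refine ⟨by rw [α.smul]; exact ENNReal.mul_lt_top enorm_lt_top hfin, fun n => c • s n, ?_⟩
  simp_rw [UniformSpace.Completion.coe_smul, ← smul_sub, α.smul]
  simpa using ENNReal.Tendsto.const_mul hs (Or.inr (enorm_ne_top (x := c)))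

theorem zero_mem_tensor : (0 : ProjTensor X Y) ∈ α.tensor X Y := by
  refine ⟨by simp [α.toFun_zero], fun _ => 0, ?_⟩
  simp_rw [UniformSpace.Completion.coe_zero, sub_zero, α.toFun_zero]
  exact tendsto_const_nhds

theorem add_mem_tensor {w w' : ProjTensor X Y} (hw : w ∈ α.tensor X Y) (hw' : w' ∈ α.tensor X Y) :
    w + w' ∈ α.tensor X Y := by
  obtain ⟨C, -, hC⟩ := α.add
  obtain ⟨hfin, s, hs⟩ := hw
  obtain ⟨hfin', s', hs'⟩ := hw'
  refine ⟨(hC X Y w w').trans_lt (ENNReal.mul_lt_top ENNReal.coe_lt_top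
    (ENNReal.add_lt_top.2 ⟨hfin, hfin'⟩)), fun n => s n + s' n, ?_⟩
  have h : Tendsto (fun n => (C : ℝ≥0∞) * (α.toFun X Y (w - s n) + α.toFun X Y (w' - s' n)))
      atTop (𝓝 0) := by
    simpa using ENNReal.Tendsto.const_mul (hs.add hs') (Or.inr (ENNReal.coe_ne_top (r := C)))
  refine tendsto_of_tendsto_of_tendsto_of_le_of_le tendsto_const_nhds h (fun _ => zero_le)
    fun n => ?_
  dsimp only
  rw [UniformSpace.Completion.coe_add, add_sub_add_comm]
  exact hC X Y _ _

theorem sum_mem_tensor {ι : Type*} (F : Finset ι) {w : ι → ProjTensor X Y}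
    (hw : ∀ i ∈ F, w i ∈ α.tensor X Y) : ∑ i ∈ F, w i ∈ α.tensor X Y :=
  Finset.sum_induction w (· ∈ α.tensor X Y) (fun _ _ => α.add_mem_tensor) α.zero_mem_tensor hw

theorem map_mem_tensor (A : X →L[ℂ] X') (B : Y →L[ℂ] Y') {w : ProjTensor X Y}
    (hw : w ∈ α.tensor X Y) : ProjTensor.map A B w ∈ α.tensor X' Y' := by
  obtain ⟨hfin, s, hs⟩ := hw
  refine ⟨(α.map X Y X' Y' A B w).trans_lt
    (ENNReal.mul_lt_top (ENNReal.mul_lt_top enorm_lt_top hfin) enorm_lt_top),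
    fun n => AlgTensor.map A B (s n), ?_⟩
  have h : Tendsto (fun n => ‖A‖ₑ * α.toFun X Y (w - s n) * ‖B‖ₑ) atTop (𝓝 0) := by
    simpa using ENNReal.Tendsto.mul_const (ENNReal.Tendsto.const_mul hs
      (Or.inr (enorm_ne_top (x := A)))) (Or.inr (enorm_ne_top (x := B)))
  refine tendsto_of_tendsto_of_tendsto_of_le_of_le tendsto_const_nhds h (fun _ => zero_le)
    fun n => ?_
  have : ProjTensor.map A B w - (AlgTensor.map A B (s n) : AlgTensor X' Y') =
      ProjTensor.map A B (w - s n) := by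
    rw [map_sub, ProjTensor.map, ContinuousLinearMap.completion_apply_coe]
  dsimp only
  rw [this]
  exact α.map X Y X' Y' A B _

/-- The ratio `1 / (2C)` is small enough to absorb the quasi-triangle constant: with `D = 2C`, the
induction closes because `C * (D⁻¹ ^ m + D * D⁻¹ ^ (m + 1)) = D * D⁻¹ ^ m`. The bound does not
depend on the number of terms. -/
theorem toFun_sum_le {C : ℝ≥0} (hC1 : 1 ≤ C)
    (hC : ∀ u₁ u₂ : ProjTensor X Y,
      α.toFun X Y (u₁ + u₂) ≤ C * (α.toFun X Y u₁ + α.toFun X Y u₂))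
    {w : ℕ → ProjTensor X Y} (hw : ∀ n, α.toFun X Y (w n) ≤ ((2 * C : ℝ≥0) : ℝ≥0∞)⁻¹ ^ n)
    (K m : ℕ) : α.toFun X Y (∑ k ∈ Finset.range K, w (m + k)) ≤
      ((2 * C : ℝ≥0) : ℝ≥0∞) * ((2 * C : ℝ≥0) : ℝ≥0∞)⁻¹ ^ m := by
  set D : ℝ≥0∞ := ((2 * C : ℝ≥0) : ℝ≥0∞) with hD
  have hD0 : D ≠ 0 := by rw [hD, ENNReal.coe_ne_zero]; positivity
  have hDt : D ≠ ∞ := ENNReal.coe_ne_top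
  induction K generalizing m with
  | zero => simp [α.toFun_zero]
  | succ K ih =>
    -- The first, largest term is split off, so that the remaining sum is an instance of the
    -- induction hypothesis starting at `m + 1`.
    rw [Finset.sum_range_succ', add_comm]
    refine (hC _ _).trans ?_
    have h1 := ih (m + 1)
    simp only [add_assoc, add_comm 1] at h1
    calc _ ≤ (C : ℝ≥0∞) * (D⁻¹ ^ m + D * D⁻¹ ^ (m + 1)) := by
          gcongr
          exact hw m
      _ = D * D⁻¹ ^ m := by
          rw [pow_succ', ← mul_assoc D, ENNReal.mul_inv_cancel hD0 hDt, hD]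
          push_cast
          ring

/-- The uniform bound on blocks makes the partial sums `α`-Cauchy. The limit is taken with respect
to `α` only; no convergence in the projective norm is claimed. -/
theorem exists_tendsto_sum (hα : α.IsComplete) {C : ℝ≥0} (hC1 : 1 ≤ C)
    (hC : ∀ u₁ u₂ : ProjTensor X Y,
      α.toFun X Y (u₁ + u₂) ≤ C * (α.toFun X Y u₁ + α.toFun X Y u₂))
    {w : ℕ → ProjTensor X Y} (hwt : ∀ n, w n ∈ α.tensor X Y)
    (hw : ∀ n, α.toFun X Y (w n) ≤ ((2 * C : ℝ≥0) : ℝ≥0∞)⁻¹ ^ n) :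
    ∃ z ∈ α.tensor X Y,
      Tendsto (fun N => α.toFun X Y (∑ n ∈ Finset.range N, w n - z)) atTop (𝓝 0) := by
  refine hα X Y _ (fun N => α.sum_mem_tensor _ fun n _ => hwt n) fun ε hε => ?_
  have hlt : ((2 * C : ℝ≥0) : ℝ≥0∞)⁻¹ < 1 := by
    rw [ENNReal.inv_lt_one]
    exact_mod_cast lt_of_lt_of_le (by norm_num : (1 : ℝ≥0) < 2 * 1) (by gcongr)
  have hlim : Tendsto (fun m => ((2 * C : ℝ≥0) : ℝ≥0∞) * ((2 * C : ℝ≥0) : ℝ≥0∞)⁻¹ ^ m)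
      atTop (𝓝 0) := by
    simpa using ENNReal.Tendsto.const_mul (ENNReal.tendsto_pow_atTop_nhds_zero_of_lt_one hlt)
      (Or.inr (ENNReal.coe_ne_top (r := 2 * C)))
  obtain ⟨N, hN⟩ := eventually_atTop.1 (hlim.eventually_lt_const hε)
  have key : ∀ m ≥ N, ∀ n ≥ m,
      α.toFun X Y (∑ k ∈ Finset.range n, w k - ∑ k ∈ Finset.range m, w k) < ε := by
    intro m hm n hn
    obtain ⟨K, rfl⟩ := Nat.exists_eq_add_of_le hn
    rw [Finset.sum_range_add, add_sub_cancel_left]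
    exact (α.toFun_sum_le hC1 hC hw K m).trans_lt (hN m hm)
  refine ⟨N, fun m hm n hn => ?_⟩
  rcases le_total n m with h | h
  · exact key n hn m h
  · rw [← α.toFun_neg, neg_sub]
    exact key m hm n h

end

section

variable {X Y : Type v} [NormedAddCommGroup X] [NormedSpace ℂ X]
  [NormedAddCommGroup Y] [NormedSpace ℂ Y] [CompleteSpace Y]

/-- The operator norm of `ũ` is dominated by `α u`. -/
theorem enorm_toOp_apply_le (w : ProjTensor (StrongDual ℂ X) Y) (x : X) :
    ‖ProjTensor.toOp w x‖ₑ ≤ ‖x‖ₑ * α.toFun (StrongDual ℂ X) Y w := by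
  rcases eq_or_ne x 0 with rfl | hx
  · simp
  -- Any functional of norm one would do. Applying `f ↦ f x • f₀`, of norm at most `‖x‖`, to the
  -- first factor turns `w` into `f₀ ⊗ ũ(x)`, whose `α`-value is `‖ũ(x)‖` by the cross-norm
  -- property.
  obtain ⟨f₀, hf₀, -⟩ := exists_dual_vector ℂ x (norm_ne_zero_iff.2 hx)
  have hf : ‖f₀‖ₑ = 1 := by rw [← ofReal_norm, hf₀]; simp
  have hA : ‖(ContinuousLinearMap.apply ℂ ℂ x).smulRight f₀‖ₑ ≤ ‖x‖ₑ := by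
    rw [enorm_le_iff_norm_le, ContinuousLinearMap.norm_smulRight_apply, hf₀, mul_one]
    refine ContinuousLinearMap.opNorm_le_bound _ (norm_nonneg x) fun f => ?_
    rw [mul_comm]
    exact f.le_opNorm x
  have hB : ‖ContinuousLinearMap.id ℂ Y‖ₑ ≤ 1 := by
    rw [← ofReal_norm]
    exact ENNReal.ofReal_le_one.2 ContinuousLinearMap.norm_id_le
  have h := α.map (StrongDual ℂ X) Y (StrongDual ℂ X) Y
    ((ContinuousLinearMap.apply ℂ ℂ x).smulRight f₀) (ContinuousLinearMap.id ℂ Y) w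
  rw [ProjTensor.map_eval_smulRight, α.tmul, hf, one_mul] at h
  calc _ ≤ _ := h
    _ ≤ ‖x‖ₑ * α.toFun (StrongDual ℂ X) Y w * 1 := by gcongr
    _ = _ := mul_one _

/-- This is what permits computing the operator induced by an `α`-limit pointwise from the
approximating tensors. -/
theorem tendsto_toOp_apply {s : ℕ → ProjTensor (StrongDual ℂ X) Y}
    {w : ProjTensor (StrongDual ℂ X) Y}
    (h : Tendsto (fun n => α.toFun (StrongDual ℂ X) Y (s n - w)) atTop (𝓝 0)) (x : X) :
    Tendsto (fun n => ProjTensor.toOp (s n) x) atTop (𝓝 (ProjTensor.toOp w x)) := by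
  rw [tendsto_iff_edist_tendsto_0]
  have h' : Tendsto (fun n => ‖x‖ₑ * α.toFun (StrongDual ℂ X) Y (s n - w)) atTop (𝓝 0) := by
    simpa using ENNReal.Tendsto.const_mul h (Or.inr (enorm_ne_top (x := x)))
  refine tendsto_of_tendsto_of_tendsto_of_le_of_le tendsto_const_nhds h' (fun _ => zero_le)
    fun n => ?_
  dsimp only
  rw [edist_eq_enorm_sub, ← sub_apply, ← map_sub]
  exact α.enorm_toOp_apply_le _ x

end

end ProjTensorQuasinorm

/-! ### Monotonicity and homogeneity of the Lorentz quasinorm. -/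

section Lorentz

variable {ι κ : Type*}

/-- If `J` may be discarded from `κ`, its preimage may be discarded from `ι`: by injectivity it is
no larger, and what remains is sent outside `J`. -/
theorem rearrangement_comp_le (b : κ → ℂ) {φ : ι → κ} (hφ : Function.Injective φ) (n : ℕ) :
    rearrangement (b ∘ φ) n ≤ rearrangement b n := by
  refine le_iInf fun J => ?_
  have hcard : (J.1.preimage φ hφ.injOn).card < n :=
    (Finset.card_le_card_of_injOn φ (fun i hi => Finset.mem_preimage.1 hi) hφ.injOn).trans_lt J.2
  refine (iInf_le _ ⟨J.1.preimage φ hφ.injOn, hcard⟩).trans (iSup_le fun j => ?_)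
  exact le_iSup (fun k : {k : κ // k ∉ J.1} => ‖b k‖ₑ)
    ⟨φ j.1, fun hj => j.2 ((Finset.mem_preimage (hf := hφ.injOn)).2 hj)⟩

theorem rearrangement_const_mul (c : ℂ) (a : ι → ℂ) (n : ℕ) :
    rearrangement (fun i => c * a i) (n + 1) = ‖c‖ₑ * rearrangement a (n + 1) := by
  -- The shift to `n + 1` matters: at index `0` no set is admissible, the infimum is `∞`, and the
  -- identity would fail for `c = 0`.
  have : Nonempty {J : Finset ι // J.card < n + 1} := ⟨⟨∅, by simp⟩⟩
  simp only [rearrangement, enorm_mul, ← ENNReal.mul_iSup]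
  rw [ENNReal.mul_iInf fun h => absurd h enorm_ne_top]

theorem lorentzNorm_mono (p : ℝ) (q : ℝ≥0∞) {a : ι → ℂ} {b : κ → ℂ}
    (h : ∀ n, rearrangement a n ≤ rearrangement b n) : lorentzNorm p q a ≤ lorentzNorm p q b := by
  unfold lorentzNorm
  split_ifs
  · gcongr
    exact h _
  · gcongr with n
    exact h _

theorem lorentzNorm_const_mul (p : ℝ) {q : ℝ≥0∞} (hq : 0 < q) (c : ℂ) (a : ι → ℂ) :
    lorentzNorm p q (fun i => c * a i) = ‖c‖ₑ * lorentzNorm p q a := by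
  unfold lorentzNorm
  simp only [rearrangement_const_mul]
  split_ifs with h
  · simp only [mul_assoc, ← ENNReal.mul_iSup]
  · have hq' : 0 < q.toReal := ENNReal.toReal_pos hq.ne' h
    simp only [ENNReal.mul_rpow_of_nonneg _ _ hq'.le, mul_assoc, ENNReal.tsum_mul_left]
    rw [ENNReal.mul_rpow_of_nonneg _ _ (by positivity), ← ENNReal.rpow_mul,
      mul_one_div_cancel hq'.ne', ENNReal.rpow_one]

end Lorentz

/-! ### Eigenvalues under an intertwining embedding. -/

section Spectral

variable {X Z : Type*} [NormedAddCommGroup X] [NormedSpace ℂ X]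
  [NormedAddCommGroup Z] [NormedSpace ℂ Z]

/-- The relation `T J = c J S` gives `(T - cμ) J = c J (S - μ)`, which iterates to `(T - cμ)^k J =
c^k J (S - μ)^k`. -/
theorem map_mem_rootSpace {S : X →L[ℂ] X} {T : Z →L[ℂ] Z} {J : X →L[ℂ] Z} {c : ℂ}
    (h : ∀ x, T (J x) = c • J (S x)) {μ : ℂ} {x : X} (hx : x ∈ rootSpace S μ) :
    J x ∈ rootSpace T (c * μ) := by
  rw [rootSpace, Module.End.mem_maxGenEigenspace] at hx ⊢
  obtain ⟨k, hk⟩ := hx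
  have key : ∀ k x, (((T : Z →ₗ[ℂ] Z) - (c * μ) • (1 : Module.End ℂ Z)) ^ k) (J x) =
      c ^ k • J ((((S : X →ₗ[ℂ] X) - μ • (1 : Module.End ℂ X)) ^ k) x) := by
    intro k
    induction k with
    | zero => simp
    | succ k ih =>
      intro x
      have h1 : ((T : Z →ₗ[ℂ] Z) - (c * μ) • (1 : Module.End ℂ Z)) (J x) =
          c • J (((S : X →ₗ[ℂ] X) - μ • (1 : Module.End ℂ X)) x) := by
        simp [h, smul_sub, mul_smul]
      rw [pow_succ, Module.End.mul_apply, h1, map_smul, ih, pow_succ (_ - _), Module.End.mul_apply,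
        smul_smul, pow_succ']
  exact ⟨k, by rw [key, hk, map_zero, smul_zero]⟩

/-- If `T J = c J S` with `J` injective, then the eigenvalues of `T` include those of `c S`, with
multiplicity. -/
theorem enorm_mul_lorentzNorm_eigenvalueFamily_le {p : ℝ} {q : ℝ≥0∞} (hq : 0 < q)
    {S : X →L[ℂ] X} {T : Z →L[ℂ] Z} {J : X →L[ℂ] Z} (hJ : Function.Injective J) {c : ℂ}
    (hc : c ≠ 0) (h : ∀ x, T (J x) = c • J (S x))
    (hfin : ∀ μ ∈ nonzeroEigenvalues T, FiniteDimensional ℂ (rootSpace T μ)) :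
    ‖c‖ₑ * lorentzNorm p q (eigenvalueFamily S) ≤ lorentzNorm p q (eigenvalueFamily T) := by
  have hmem : ∀ μ ∈ nonzeroEigenvalues S, c * μ ∈ nonzeroEigenvalues T := by
    rintro μ ⟨hμ, hev⟩
    obtain ⟨x, hx⟩ := hev.exists_hasEigenvector
    refine ⟨mul_ne_zero hc hμ, Module.End.hasEigenvalue_of_hasEigenvector (x := J x) ?_⟩
    refine Module.End.hasEigenvector_iff.2
      ⟨Module.End.mem_eigenspace_iff.2 ?_, fun h0 => hx.2 (hJ (h0.trans (map_zero J).symm))⟩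
    have hx' : S x = μ • x := hx.apply_eq_smul
    rw [ContinuousLinearMap.coe_coe, h, hx', map_smul, smul_smul]
  have hdim : ∀ μ ∈ nonzeroEigenvalues S,
      Module.finrank ℂ (rootSpace S μ) ≤ Module.finrank ℂ (rootSpace T (c * μ)) := by
    intro μ hμ
    -- Finite dimension of the target is essential, since `finrank` of an infinite-dimensional root
    -- space is `0`.
    have := hfin _ (hmem μ hμ)
    let R : rootSpace S μ →ₗ[ℂ] rootSpace T (c * μ) :=
      (J : X →ₗ[ℂ] Z).restrict fun x hx => map_mem_rootSpace h hx
    refine LinearMap.finrank_le_finrank_of_injective (f := R) fun x y hxy => ?_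
    exact Subtype.ext (hJ (congrArg Subtype.val hxy))
  -- Each copy of `μ` is matched with the copy of `c * μ` of the same index. This is injective
  -- because `c ≠ 0`, and `eigenvalueFamily T ∘ φ` is `c` times `eigenvalueFamily S`.
  let φ : (Σ μ : nonzeroEigenvalues S, Fin (Module.finrank ℂ (rootSpace S μ))) →
      (Σ μ : nonzeroEigenvalues T, Fin (Module.finrank ℂ (rootSpace T μ))) :=
    fun i => ⟨⟨c * i.1, hmem _ i.1.2⟩, Fin.castLE (hdim _ i.1.2) i.2⟩
  have hφ : Function.Injective φ := by
    rintro ⟨⟨μ, hμ⟩, i⟩ ⟨⟨ν, hν⟩, j⟩ hij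
    have h1 : c * μ = c * ν := congrArg (fun k => (k.1 : ℂ)) hij
    obtain rfl := mul_left_cancel₀ hc h1
    have h2 : (i : ℕ) = j := congrArg (fun k => (k.2 : ℕ)) hij
    obtain rfl := Fin.ext h2
    rfl
  rw [← lorentzNorm_const_mul p hq]
  exact lorentzNorm_mono p q fun n => rearrangement_comp_le (eigenvalueFamily T) hφ n

end Spectral

/-! ### Projections and embeddings of the direct sum. -/

namespace BanachDirectSum

variable {E : Type*} [NormedAddCommGroup E] [NormedSpace ℂ E] [CompleteSpace E]
  (e : OneUnconditionalBasis E) (X : ℕ → Type v) [∀ n, NormedAddCommGroup (X n)]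
  [∀ n, NormedSpace ℂ (X n)]

/-- The coordinate projection `(∑ Xₙ)_E → Xₙ`. -/
def proj (n : ℕ) : BanachDirectSum e X →L[ℂ] X n :=
  LinearMap.mkContinuous
    { toFun := fun x => x.coord n
      map_add' := fun x y => coord_add x y n
      map_smul' := fun c x => coord_smul c x n } 1
    (fun x => by simpa using norm_coord_le x n)

/-- The sequence with `n`-th term `x` and all other terms `0`. -/
def single (n : ℕ) (x : X n) : BanachDirectSum e X :=
  ⟨Pi.single n x, summable_of_ne_finset_zero (s := {n}) fun k hk => by
    have : k ≠ n := by simpa using hk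
    simp [this]⟩

theorem coord_single (n : ℕ) (x : X n) (m : ℕ) :
    (single e X n x).coord m = (Pi.single n x : ∀ n, X n) m := rfl

theorem norm_single (n : ℕ) (x : X n) : ‖single e X n x‖ = ‖x‖ := by
  rw [norm_def, tsum_eq_single n fun m hm => by simp [coord_single, hm], coord_single,
    Pi.single_eq_same, norm_smul, e.norm_eq_one, mul_one, Complex.norm_real, norm_norm]

/-- The isometric embedding `Xₙ → (∑ Xₙ)_E`. -/
def incl (n : ℕ) : X n →ₗᵢ[ℂ] BanachDirectSum e X where
  toFun := single e X n
  map_add' x y := ext fun m => congrFun (Pi.single_add n x y) m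
  map_smul' c x := ext fun m => congrFun (Pi.single_smul n c x) m
  norm_map' := norm_single e X n

theorem proj_incl_self (n : ℕ) (x : X n) : proj e X n (incl e X n x) = x :=
  Pi.single_eq_same n x

theorem proj_incl_of_ne {n m : ℕ} (h : n ≠ m) (x : X m) : proj e X n (incl e X m x) = 0 :=
  Pi.single_eq_of_ne h x

end BanachDirectSum

/-! ### Direct sums and scaling of nuclear operators. -/

/-- In a Banach space containing complemented copies of all `Xₙ`, mutually annihilated by the
projections, an `α`-summable sequence of `α`-nuclear operators on the `Xₙ` has a direct sum that
is `α`-nuclear. -/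
theorem ProjTensorQuasinorm.exists_nuclear_directSum (α : ProjTensorQuasinorm.{v})
    (hα : α.IsComplete) {C : ℝ≥0} (hC1 : 1 ≤ C) {Z : Type v} [NormedAddCommGroup Z]
    [NormedSpace ℂ Z] [CompleteSpace Z]
    (hC : ∀ u₁ u₂ : ProjTensor (StrongDual ℂ Z) Z,
      α.toFun (StrongDual ℂ Z) Z (u₁ + u₂) ≤
        C * (α.toFun (StrongDual ℂ Z) Z u₁ + α.toFun (StrongDual ℂ Z) Z u₂))
    {X : ℕ → Type v} [∀ n, NormedAddCommGroup (X n)] [∀ n, NormedSpace ℂ (X n)]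
    [∀ n, CompleteSpace (X n)] (P : ∀ n, Z →L[ℂ] X n) (J : ∀ n, X n →L[ℂ] Z)
    (hP : ∀ n, ‖P n‖ ≤ 1) (hJ : ∀ n, ‖J n‖ ≤ 1) (hPJ : ∀ n x, P n (J n x) = x)
    (hPJ' : ∀ n m, n ≠ m → ∀ x, P n (J m x) = 0)
    {w : ∀ n, ProjTensor (StrongDual ℂ (X n)) (X n)}
    (hwt : ∀ n, w n ∈ α.tensor (StrongDual ℂ (X n)) (X n))
    (hw : ∀ n, α.toFun (StrongDual ℂ (X n)) (X n) (w n) ≤ ((2 * C : ℝ≥0) : ℝ≥0∞)⁻¹ ^ n) :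
    ∃ T ∈ α.nuclear Z Z, ∀ n x, T (J n x) = J n (ProjTensor.toOp (w n) x) := by
  have hP' : ∀ n, ‖(ContinuousLinearMap.precomp ℂ (P n) :
      StrongDual ℂ (X n) →L[ℂ] StrongDual ℂ Z)‖ ≤ 1 := by
    intro n
    refine ContinuousLinearMap.opNorm_le_bound _ zero_le_one fun f => ?_
    rw [one_mul]
    exact (ContinuousLinearMap.opNorm_comp_le f (P n)).trans
      (mul_le_of_le_one_right (norm_nonneg f) (hP n))
  have hmem : ∀ n, ProjTensor.map (ContinuousLinearMap.precomp ℂ (P n)) (J n) (w n) ∈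
      α.tensor (StrongDual ℂ Z) Z :=
    fun n => α.map_mem_tensor (X := StrongDual ℂ (X n)) (Y := X n) _ _ (hwt n)
  have hle : ∀ n, α.toFun (StrongDual ℂ Z) Z
      (ProjTensor.map (ContinuousLinearMap.precomp ℂ (P n)) (J n) (w n)) ≤
        ((2 * C : ℝ≥0) : ℝ≥0∞)⁻¹ ^ n :=
    fun n => (α.toFun_map_le (X := StrongDual ℂ (X n)) (Y := X n) (hP' n) (hJ n) (w n)).trans
      (hw n)
  obtain ⟨z, hz, hlim⟩ := α.exists_tendsto_sum hα hC1 hC hmem hle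
  refine ⟨ProjTensor.toOp z, ⟨z, hz, rfl⟩, fun m x => ?_⟩
  -- On the range of `J m` only the `m`-th summand survives, so the partial sums are constant once
  -- `N > m`, and their limit is that constant.
  refine tendsto_nhds_unique (α.tendsto_toOp_apply hlim (J m x))
    (tendsto_const_nhds.congr' ((eventually_gt_atTop m).mono fun N hN => ?_))
  dsimp only
  rw [map_sum, sum_apply, Finset.sum_eq_single m]
  · rw [ProjTensor.toOp_map, ContinuousLinearMap.comp_apply, ContinuousLinearMap.comp_apply, hPJ]
  · intro n _ hn
    rw [ProjTensor.toOp_map, ContinuousLinearMap.comp_apply, ContinuousLinearMap.comp_apply,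
      hPJ' n m hn, map_zero, map_zero]
  · intro h
    exact absurd (Finset.mem_range.2 hN) h

/-- An operator violating the bound `n / r` yields, after scaling, a tensor with `α`-value at most
`r` inducing a multiple `c T` whose eigenvalues have Lorentz quasinorm at least `n`. -/
theorem ProjTensorQuasinorm.exists_scaled_tensor (α : ProjTensorQuasinorm.{v}) {X : Type v}
    [NormedAddCommGroup X] [NormedSpace ℂ X] [CompleteSpace X] {T : X →L[ℂ] X} {L r b : ℝ≥0}
    (hr : 0 < r) (hb : 0 < b) (hL : (b * r⁻¹ : ℝ≥0) * α.nuclearNorm T < L) :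
    ∃ c : ℂ, c ≠ 0 ∧ ‖c‖ₑ * L = b ∧ ∃ w ∈ α.tensor (StrongDual ℂ X) X,
      α.toFun (StrongDual ℂ X) X w ≤ r ∧ ProjTensor.toOp w = c • T := by
  have hL0 : L ≠ 0 := by
    rintro rfl
    simp at hL
  have hbr : b * r⁻¹ ≠ 0 := (mul_pos hb (inv_pos.2 hr)).ne'
  -- Strictness allows choosing a representing tensor still below this bound, although the infimum
  -- need not be attained.
  have h1 : α.nuclearNorm T < (L / (b * r⁻¹) : ℝ≥0) := by
    rw [ENNReal.coe_div hbr, ENNReal.lt_div_iff_mul_lt (Or.inl (by exact_mod_cast hbr))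
      (Or.inl ENNReal.coe_ne_top), mul_comm]
    exact hL
  rw [nuclearNorm] at h1
  simp only [iInf_lt_iff] at h1
  obtain ⟨w, ⟨hw, hwT⟩, hlt⟩ := h1
  have hcn : ‖(((b / L : ℝ≥0) : ℝ) : ℂ)‖ₑ = ((b / L : ℝ≥0) : ℝ≥0∞) := by
    rw [enorm_eq_nnnorm]
    congr 1
    ext
    simp
  -- With `c = b / L` one has `c * L = b`, while `α (c • w) ≤ (b / L) * (L * r / b) = r`.
  refine ⟨(((b / L : ℝ≥0) : ℝ) : ℂ), ?_, ?_, (((b / L : ℝ≥0) : ℝ) : ℂ) • w,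
    α.smul_mem_tensor _ hw, ?_, by rw [map_smul, hwT]⟩
  · exact_mod_cast (div_pos hb (pos_iff_ne_zero.2 hL0)).ne'
  · rw [hcn, ← ENNReal.coe_mul, div_mul_cancel₀ _ hL0]
  · rw [α.smul, hcn]
    calc _ ≤ ((b / L : ℝ≥0) : ℝ≥0∞) * (L / (b * r⁻¹) : ℝ≥0) := by gcongr
      _ = r := by
        rw [← ENNReal.coe_mul]
        congr 1
        field_simp

end NuclearSpectral

end

/-! ### The uniform boundedness principle. -/

theorem mainTheorem6 {t : ℝ} (ht : 0 < t) {u : ℝ≥0∞} (hu : 0 < u)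
    (α : ProjTensorQuasinorm.{v}) (hα : α.IsComplete)
    {E : Type w} [NormedAddCommGroup E] [NormedSpace ℂ E] [CompleteSpace E]
    (e : OneUnconditionalBasis E)
    (𝓕 : Set BanachSp.{v}) (h𝓕 : ClosedUnderDirectSums e 𝓕)
    (hspec : ∀ X ∈ 𝓕, OfSpectralType (α.nuclear X X) t u) :
    ∃ C : ℝ, 0 < C ∧ ∀ X ∈ 𝓕, ∀ T ∈ α.nuclear X X,
      lorentzNorm t u (eigenvalueFamily T) ≤ ENNReal.ofReal C * α.nuclearNorm T := by
  -- One constant for all spaces is needed: the weights `(2C)^(-n)` are fixed before the space `Z`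
  -- on which the series is summed is known.
  obtain ⟨C, hC1, hC⟩ := α.exists_one_le_add
  by_contra! hcon
  have hr : ∀ n : ℕ, 0 < ((2 * C)⁻¹ ^ n : ℝ≥0) := fun n => by
    have : 0 < C := zero_lt_one.trans_le hC1
    positivity
  have hb : ∀ n : ℕ, 0 < ((n : ℝ≥0) + 1) := fun n => by positivity
  -- In the violated constant, `(2C)^n` pays for summability and `n + 1` is the growth that remains;
  -- `n + 1` instead of `n` keeps it positive at `n = 0`.
  choose X hX T hT hlt using fun n : ℕ =>
    hcon (((n : ℝ≥0) + 1) * ((2 * C)⁻¹ ^ n)⁻¹ : ℝ≥0)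
      (NNReal.coe_pos.2 (mul_pos (hb n) (inv_pos.2 (hr n))))
  simp only [ENNReal.ofReal_coe_nnreal] at hlt
  -- Finiteness comes from the spectral type of each `T n`; without it the quasinorm could not be
  -- normalized to `n + 1`.
  have hfin : ∀ n, ∃ l : ℝ≥0, (l : ℝ≥0∞) = lorentzNorm t u (eigenvalueFamily (T n)) :=
    fun n => ⟨_, ENNReal.coe_toNNReal (hspec (X n) (hX n) (T n) (hT n)).memLorentz.2.ne⟩
  choose L hL using hfin
  choose c hc0 hcL w hw hwr hwT using fun n =>
    α.exists_scaled_tensor (hr n) (hb n) ((hlt n).trans_eq (hL n).symm)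
  obtain ⟨Z, hZ, ⟨Φ⟩⟩ := h𝓕 X hX
  let P : ∀ n, Z →L[ℂ] X n := fun n =>
    BanachDirectSum.proj e (fun n => X n) n ∘L (Φ : Z →L[ℂ] BanachDirectSum e fun n => X n)
  let J : ∀ n, X n →ₗᵢ[ℂ] Z := fun n =>
    Φ.symm.toLinearIsometry.comp (BanachDirectSum.incl e (fun n => X n) n)
  have hPJ : ∀ n m x, P n (J m x) =
      BanachDirectSum.proj e (fun n => X n) n (BanachDirectSum.incl e (fun n => X n) m x) :=
    fun n m x => congrArg (BanachDirectSum.proj e (fun n => X n) n) (Φ.apply_symm_apply _)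
  obtain ⟨S, hS, hSJ⟩ := α.exists_nuclear_directSum hα hC1 (hC (StrongDual ℂ Z) Z) P
    (fun n => (J n).toContinuousLinearMap)
    (fun n => ContinuousLinearMap.opNorm_le_bound _ zero_le_one fun z => by
      rw [one_mul, ← Φ.norm_map z]
      exact BanachDirectSum.norm_coord_le (Φ z) n)
    (fun n => (J n).norm_toContinuousLinearMap_le)
    (fun n x => (hPJ n n x).trans (BanachDirectSum.proj_incl_self e (fun n => X n) n x))
    (fun n m h x => (hPJ n m x).trans (BanachDirectSum.proj_incl_of_ne e (fun n => X n) h x))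
    hw (fun n => (hwr n).trans_eq (by
      have : (2 * C) ≠ 0 := (mul_pos two_pos (zero_lt_one.trans_le hC1)).ne'
      rw [ENNReal.coe_pow, ENNReal.coe_inv this]))
  have hspecS := hspec Z hZ S hS
  -- The finite eigenvalue quasinorm of `S` lies below some `n`, whereas the `n`-th summand alone
  -- forces it to be at least `n + 1`.
  obtain ⟨n, hn⟩ := ENNReal.exists_nat_gt hspecS.memLorentz.2.ne
  have hle := enorm_mul_lorentzNorm_eigenvalueFamily_le (p := t) hu (J n).injective (hc0 n)
    (fun x => by rw [hSJ n x, hwT n]; exact map_smul (J n) _ _) hspecS.finite_mult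
  rw [← hL n, hcL n] at hle
  refine (hle.trans_lt hn).not_ge ?_
  push_cast
  exact le_self_add
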